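/- A full Steiner topology on $n\ge 3$ terminals is a finite tree with $n$ distinguished vertices (the terminals), all of degree $1$, all of whose other vertices (the Steiner points) have degree $3$. A full Steiner tree $T$ in $\mathbb{R}^2$ is a straight-line representation of such a topology, where vertices may coincide and edges may cross; its length $L(T)$ is the sum of the Euclidean lengths of its edges. It is $\varepsilon$-approximate if no edge has length $0$ and each angle in $[0,\pi]$ between two edges at a Steiner point lies in $[2\pi/3-\varepsilon,\,2\pi/3+\varepsilon]$. Let $S(T)$ be the shortest tree with the same terminals and the same topology as $T$, where edges of length $0$ are allowed, and let \[F_2(\varepsilon,n)=\sup_T \frac{L(T)-L(S(T))}{L(S(T))}\in[0,\infty],\] the supremum being over all full $\varepsilon$-approximate Steiner trees $T$ on $n$ terminals in $\mathbb{R}^2$. Then the following hold. (1) For every $\varepsilon_1<2\pi/3$ there is a constant $C$, depending only on $\varepsilon_1$, such that for all integers $n\ge 3$ and all real $\varepsilon$ with $0<\varepsilon<\pi/(n-2)$ and $\varepsilon\le\varepsilon_1$, \[F_2(\varepsilon,n)\le C\,n^2\varepsilon^2 .\] (The condition $\varepsilon\le\varepsilon_1$ restricts only the case $n=3$: for $n\ge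 4$ it follows from $\varepsilon<\pi/(n-2)$ with $\varepsilon_1=\pi/2$, so that $C$ is then an absolute constant.) (2) Consequently, if $\varepsilon=O(1/n^2)$ as $n\to\infty$, then $F_2(\varepsilon,n)=O(\varepsilon)$: for every $K$ there are $C$ and $N$ such that for all integers $n\ge N$ with $n\geq 3$ and all real $\varepsilon$ with $0<\varepsilon\le K/n^2$, $F_2(\varepsilon,n)\le C\varepsilon$. -/

import Mathlib

open scoped ENNReal

noncomputable section

/-- A Steiner topology for `n` terminals: a finite tree with `n` distinguished vertices
`Sum.inl i` (the terminals `t₁, …, tₙ`), all of degree at most `3`, all of whose other vertices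
`Sum.inr j` (the Steiner points) have degree exactly `3`. -/
structure SteinerTopology (n : ℕ) where
  /-- The number of Steiner points. -/
  numSteiner : ℕ
  /-- The underlying graph. -/
  graph : SimpleGraph (Fin n ⊕ Fin numSteiner)
  isTree : graph.IsTree
  terminal_degree : ∀ i : Fin n, (graph.neighborSet (Sum.inl i)).ncard ≤ 3
  steiner_degree : ∀ j : Fin numSteiner, (graph.neighborSet (Sum.inr j)).ncard = 3

namespace SteinerTopology

/-- The vertices of the topology: terminals and Steiner points. -/
abbrev Vertex {n : ℕ} (τ : SteinerTopology n) : Type := Fin n ⊕ Fin τ.numSteiner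

/-- A Steiner topology is full if all its terminals have degree `1`. -/
def IsFull {n : ℕ} (τ : SteinerTopology n) : Prop :=
  ∀ i : Fin n, (τ.graph.neighborSet (Sum.inl i)).ncard = 1

open Classical in
/-- The length of the representation of the topology `τ` in `ℝᵈ` that puts each vertex `v` at the
point `x v`: the sum over the edges `vw` of the Euclidean lengths of the segments
`x v x w`. -/
def length {n d : ℕ} (τ : SteinerTopology n) (x : τ.Vertex → EuclideanSpace ℝ (Fin d)) : ℝ :=
  ∑ e ∈ τ.graph.edgeFinset,
    Sym2.lift ⟨fun v w => dist (x v) (x w), fun v w => dist_comm (x v) (x w)⟩ e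

end SteinerTopology

/-- A Steiner tree in `ℝᵈ` on `n` terminals: a Steiner topology together with a straight-line
representation of it. Points may coincide and edges may cross. -/
structure SteinerTree (d n : ℕ) where
  /-- The topology of the tree. -/
  topology : SteinerTopology n
  /-- The points of `ℝᵈ` that represent the vertices. -/
  pos : topology.Vertex → EuclideanSpace ℝ (Fin d)

namespace SteinerTree

variable {d n : ℕ}

/-- The length `L(T)`. -/
def length (T : SteinerTree d n) : ℝ :=
  T.topology.length T.pos

/-- The length `L(S(T))` of the shortest tree with the same terminals (in the same positions) and
the same topology as `T`, where the Steiner points may be anywhere and edges may be degenerate. -/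
def shortestLength (T : SteinerTree d n) : ℝ :=
  ⨅ x : {x : T.topology.Vertex → EuclideanSpace ℝ (Fin d) //
      ∀ i : Fin n, x (Sum.inl i) = T.pos (Sum.inl i)},
    T.topology.length x.1

/-- No edge of the tree has length `0`. -/
def IsNondegenerate (T : SteinerTree d n) : Prop :=
  ∀ v w, T.topology.graph.Adj v w → T.pos v ≠ T.pos w

/-- `T` is an `ε`-approximate Steiner tree: no edge is degenerate, so that the angles at the
Steiner points are defined, and the (convex) angle spanned by any two edges at a Steiner point
lies in `[2π/3 - ε, 2π/3 + ε]`. -/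
def IsApproximate (T : SteinerTree d n) (ε : ℝ) : Prop :=
  T.IsNondegenerate ∧
    ∀ (s : Fin T.topology.numSteiner) (v w : T.topology.Vertex),
      T.topology.graph.Adj (Sum.inr s) v → T.topology.graph.Adj (Sum.inr s) w → v ≠ w →
        EuclideanGeometry.angle (T.pos v) (T.pos (Sum.inr s)) (T.pos w) ∈
          Set.Icc (2 * Real.pi / 3 - ε) (2 * Real.pi / 3 + ε)

/-- The relative error `(L(T) - L(S(T))) / L(S(T))` in `[0, ∞]`; it is `∞` if
`L(S(T)) = 0 < L(T)`. -/
def relativeError (T : SteinerTree d n) : ℝ≥0∞ :=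
  ENNReal.ofReal (T.length - T.shortestLength) / ENNReal.ofReal T.shortestLength

end SteinerTree

/-- The set of all full `ε`-approximate Steiner trees on `n` terminals in `ℝᵈ`. -/
def fullApproxSteinerTrees (d : ℕ) (ε : ℝ) (n : ℕ) : Set (SteinerTree d n) :=
  {T | T.topology.IsFull ∧ T.IsApproximate ε}

/-- `F_d(ε, n)`: the supremum, in `[0, ∞]`, of the relative errors of all full `ε`-approximate
Steiner trees on `n` terminals in `ℝᵈ`. -/
def steinerF (d : ℕ) (ε : ℝ) (n : ℕ) : ℝ≥0∞ :=
  ⨆ T ∈ fullApproxSteinerTrees d ε n, T.relativeError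

end

/-! The lower bound on `L(S(T))` comes from duality. Root the tree at a terminal and put on each
edge a vector of norm at most 1, conserved at every Steiner point. By summation by parts, its
pairing with the edge vectors depends only on the terminals, and it is at most the length of every
competing tree (`sum_inner_le_shortestLength`). If the flow has inner product at least `k` with
every edge direction of `T`, then `k * L(T) ≤ L(S(T))`.

Write `N` for the number of vertices, which is at most `2n`. Three estimates cover all cases. For
`2nε ≤ 1`, the flow turns by exactly 2π/3 at each Steiner point. It drifts from the edge directions
by at most `ε` per level, and unit vectors at distance `δ` have inner product `1 - δ²/2`; hence the
quadratic error (`one_sub_mul_length_le`). Otherwise `n²ε²` is bounded below, and it suffices to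
bound `L(T) / L(S(T))`. For `n ≥ 15`, the flow follows the edge directions exactly and balances them
by weights; these change by a factor at most `exp (16ε)` per level, and `nε` is bounded
(`exp_mul_length_le`). For `n ≤ 14`, angles bounded away from 0 and π keep the Steiner points within
a bounded multiple of `L(S(T))` of the root (`length_le_of_angle`). -/

open scoped ComplexConjugate

/-! ### Rooted trees -/

/-- `par` sends each vertex other than the root `r` to its parent (and `r` to itself), and `d` is
the depth of a vertex, in the tree `G` rooted at `r`. -/
structure SimpleGraph.IsRooting {V : Type*} [Fintype V] (G : SimpleGraph V) (r : V) (par : V → V)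
    (d : V → ℕ) : Prop where
  par_root : par r = r
  adj_par : ∀ v, v ≠ r → G.Adj (par v) v
  depth_root : d r = 0
  depth_succ : ∀ v, v ≠ r → d v = d (par v) + 1
  depth_lt : ∀ v, d v < Fintype.card V
  eq_par_of_adj : ∀ u v, G.Adj u v → (v ≠ r ∧ par v = u) ∨ (u ≠ r ∧ par u = v)
  sum_edgeFinset : ∀ (_ : Fintype G.edgeSet) (f : Sym2 V → ℝ), f s(r, r) = 0 →
    ∑ e ∈ G.edgeFinset, f e = ∑ v, f s(par v, v)

theorem SimpleGraph.Connected.exists_adj_dist_eq {V : Type*} {G : SimpleGraph V}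
    (hG : G.Connected) (r v : V) (hv : v ≠ r) : ∃ u, G.Adj u v ∧ G.dist r v = G.dist r u + 1 := by
  obtain ⟨p, hp⟩ := hG.exists_walk_length_eq_dist v r
  cases p with
  | nil => exact absurd rfl hv
  | @cons _ u _ h q =>
    refine ⟨u, h.symm, ?_⟩
    have h1 : G.dist u r ≤ q.length := SimpleGraph.dist_le q
    have h2 := hG.dist_triangle (u := v) (v := u) (w := r)
    have h3 : G.dist v u = 1 := SimpleGraph.dist_eq_one_iff_adj.2 h
    rw [SimpleGraph.Walk.length_cons] at hp
    rw [SimpleGraph.dist_comm (u := r) (v := v), SimpleGraph.dist_comm (u := r) (v := u)]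
    omega

/-- Parents are chosen one step closer to `r`. The edges from parent to child are distinct, since a
swapped pair would contradict the depths, and there are `|V| - 1` of them, so they are all the
edges. In the sum over vertices the root contributes the loop `s(r, r)`, whence the condition on
`f`. -/
theorem SimpleGraph.IsTree.exists_isRooting {V : Type*} [Fintype V] {G : SimpleGraph V}
    (hG : G.IsTree) (r : V) : ∃ par d, G.IsRooting r par d := by
  classical
  have hc := hG.connected
  choose! f hf hd using hc.exists_adj_dist_eq r
  set par : V → V := fun v => if v = r then r else f v with hpar
  have hpr : par r = r := by simp [hpar]
  have hpn : ∀ v, v ≠ r → par v = f v := fun v hv => by simp [hpar, hv]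
  have hadj : ∀ v, v ≠ r → G.Adj (par v) v := fun v hv => by rw [hpn v hv]; exact hf v hv
  have hdep : ∀ v, v ≠ r → G.dist r v = G.dist r (par v) + 1 :=
    fun v hv => by rw [hpn v hv]; exact hd v hv
  have hinj : Set.InjOn (fun v => s(par v, v)) ((Finset.univ.erase r : Finset V) : Set V) := by
    intro v hv w hw h
    simp only [Finset.coe_erase, Finset.coe_univ, Set.mem_sdiff, Set.mem_univ, true_and,
      Set.mem_singleton_iff] at hv hw
    simp only [Sym2.eq_iff] at h
    rcases h with h | h
    · exact h.2
    · have h1 := hdep v hv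
      have h2 := hdep w hw
      rw [h.1] at h1
      rw [← h.2] at h2
      omega
  have himg : ∀ [Fintype G.edgeSet],
      (Finset.univ.erase r).image (fun v => s(par v, v)) = G.edgeFinset := by
    intro _
    apply Finset.eq_of_subset_of_card_le
    · intro e he
      obtain ⟨v, hv, rfl⟩ := Finset.mem_image.1 he
      rw [SimpleGraph.mem_edgeFinset, SimpleGraph.mem_edgeSet]
      exact hadj v (Finset.ne_of_mem_erase hv)
    · rw [Finset.card_image_of_injOn hinj, Finset.card_erase_of_mem (Finset.mem_univ r),
        Finset.card_univ]
      have := hG.card_edgeFinset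
      omega
  refine ⟨par, G.dist r, hpr, hadj, SimpleGraph.dist_self, hdep, ?_, ?_, ?_⟩
  · intro v
    obtain ⟨p, hp, hl⟩ := hc.exists_path_of_dist r v
    rw [← hl]
    exact hp.length_lt
  · intro u v huv
    have : s(u, v) ∈ G.edgeFinset := by simpa using huv
    rw [← himg, Finset.mem_image] at this
    obtain ⟨w, hw, h⟩ := this
    have hw := Finset.ne_of_mem_erase hw
    rw [Sym2.eq_iff] at h
    rcases h with ⟨h1, rfl⟩ | ⟨h1, rfl⟩
    · exact Or.inl ⟨hw, h1⟩
    · exact Or.inr ⟨hw, h1⟩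
  · intro _ g hg
    rw [← himg, Finset.sum_image hinj, ← Finset.add_sum_erase _ _ (Finset.mem_univ r), hpr, hg,
      zero_add]

namespace SimpleGraph.IsRooting

variable {V : Type*} [Fintype V] {G : SimpleGraph V} {r : V} {par : V → V} {d : V → ℕ}

/-- A labelling of a rooted tree can be defined by recursion from the root. -/
theorem exists_rec (hR : G.IsRooting r par d) {α : Type*} (f : V → α → α) (a : α) :
    ∃ y : V → α, y r = a ∧ ∀ v, v ≠ r → y v = f v (y (par v)) := by
  -- `Y k v` unrolls the recursion `k` times towards the root; depth many times suffice.
  let Y : ℕ → V → α := fun k => Nat.rec (fun _ => a) (fun _ g v => f v (g (par v))) k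
  refine ⟨fun v => Y (d v) v, ?_, fun v hv => ?_⟩
  · simp [Y, hR.depth_root]
  · simp [Y, hR.depth_succ v hv]

theorem induction (hR : G.IsRooting r par d) {P : V → Prop} (h0 : P r)
    (h1 : ∀ v, v ≠ r → P (par v) → P v) (v : V) : P v := by
  induction h : d v generalizing v with
  | zero =>
    by_cases hv : v = r
    · rwa [hv]
    · have := hR.depth_succ v hv
      omega
  | succ k ih =>
    by_cases hv : v = r
    · rwa [hv]
    · have := hR.depth_succ v hv
      exact h1 v hv (ih _ (by omega))

theorem neighborSet_eq (hR : G.IsRooting r par d) {v : V} (hv : v ≠ r) :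
    G.neighborSet v = insert (par v) {c | par c = v} := by
  ext w
  simp only [SimpleGraph.mem_neighborSet, Set.mem_insert_iff, Set.mem_ofPred_eq]
  constructor
  · intro h
    rcases hR.eq_par_of_adj _ _ h with h | h
    · exact Or.inr h.2
    · exact Or.inl h.2.symm
  · rintro (rfl | rfl)
    · exact (hR.adj_par _ hv).symm
    · refine hR.adj_par _ ?_
      rintro rfl
      exact hv hR.par_root

theorem par_par_ne (hR : G.IsRooting r par d) {v : V} (hv : v ≠ r) : par (par v) ≠ v := by
  intro h
  have h1 := hR.depth_succ v hv
  by_cases hp : par v = r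
  · rw [hp, hR.par_root] at h
    exact hv h.symm
  · have h2 := hR.depth_succ _ hp
    rw [h] at h2
    omega

/-- A vertex of degree `3` other than the root has two children. -/
theorem exists_children (hR : G.IsRooting r par d) {v : V} (hv : v ≠ r)
    (h3 : (G.neighborSet v).ncard = 3) :
    ∃ a b, a ≠ b ∧ (∀ c, par c = v ↔ c = a ∨ c = b) ∧ a ≠ r ∧ b ≠ r ∧ a ≠ par v ∧ b ≠ par v := by
  have hnot : par v ∉ {c | par c = v} := hR.par_par_ne hv
  rw [hR.neighborSet_eq hv, Set.ncard_insert_of_notMem hnot] at h3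
  obtain ⟨a, b, hab, h⟩ := Set.ncard_eq_two.1 (Nat.succ.inj h3)
  have h' : ∀ c, par c = v ↔ c = a ∨ c = b := fun c => by
    have := Set.ext_iff.1 h c
    simpa using this
  have hne : ∀ c, par c = v → c ≠ r ∧ c ≠ par v := by
    rintro c rfl
    refine ⟨?_, fun h => ?_⟩
    · rintro rfl
      exact hv hR.par_root
    · exact hR.par_par_ne hv (by rw [← h])
  have ha := hne a ((h' a).2 (Or.inl rfl))
  have hb := hne b ((h' b).2 (Or.inr rfl))
  exact ⟨a, b, hab, h', ha.1, hb.1, ha.2, hb.2⟩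

/-- A vertex of degree `1` other than the root has no children. -/
theorem par_ne_of_ncard_eq_one (hR : G.IsRooting r par d) {v : V} (hv : v ≠ r)
    (h1 : (G.neighborSet v).ncard = 1) (c : V) : par c ≠ v := by
  have hnot : par v ∉ {c | par c = v} := hR.par_par_ne hv
  rw [hR.neighborSet_eq hv, Set.ncard_insert_of_notMem hnot] at h1
  have h : {c | par c = v} = ∅ := by
    rw [← Set.ncard_eq_zero]
    omega
  intro hc
  have : c ∈ {c | par c = v} := hc
  simp [h] at this

end SimpleGraph.IsRooting

/-! ### Full topologies: vertex count and length -/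

namespace SteinerTopology

variable {n : ℕ} (τ : SteinerTopology n)

/-- A full Steiner topology on `n` terminals has `n - 2` Steiner points. -/
theorem IsFull.numSteiner_add_two {τ : SteinerTopology n} (h : τ.IsFull) :
    τ.numSteiner + 2 = n := by
  classical
  have h1 := τ.graph.sum_degrees_eq_twice_card_edges
  have h2 := τ.isTree.card_edgeFinset
  have hdeg : ∀ v, τ.graph.degree v = (τ.graph.neighborSet v).ncard := fun v => by
    rw [Set.ncard_eq_toFinset_card', Set.toFinset_card, SimpleGraph.card_neighborSet_eq_degree]
  rw [Fintype.sum_sum_type] at h1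
  simp only [hdeg, h _, τ.steiner_degree, Finset.sum_const, Finset.card_univ, Fintype.card_fin,
    smul_eq_mul, mul_one] at h1
  simp only [Fintype.card_sum, Fintype.card_fin] at h2
  -- The handshake identity reads `n + 3s = 2(n + s - 1)`, with `s` Steiner points.
  omega

theorem length_eq_sum {r : τ.Vertex} {par : τ.Vertex → τ.Vertex} {d : τ.Vertex → ℕ}
    (hR : τ.graph.IsRooting r par d) {m : ℕ} (x : τ.Vertex → EuclideanSpace ℝ (Fin m)) :
    τ.length x = ∑ v, dist (x (par v)) (x v) := by
  exact hR.sum_edgeFinset _ _ (by simp)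

end SteinerTopology

/-! ### Lower bounds from conserved flows -/

/-- Summation by parts on a rooted tree. -/
theorem sum_inner_sub_par {V E : Type*} [Fintype V] [DecidableEq V] [NormedAddCommGroup E]
    [InnerProductSpace ℝ E] (par : V → V) (x y : V → E) :
    ∑ v, inner ℝ (y v) (x v - x (par v)) =
      ∑ v, inner ℝ (y v - ∑ c with par c = v, y c) (x v) := by
  simp only [inner_sub_right, inner_sub_left, Finset.sum_sub_distrib, sum_inner]
  congr 1
  rw [← Finset.sum_fiberwise (s := Finset.univ) (g := par)]
  refine Finset.sum_congr rfl fun v _ => Finset.sum_congr rfl fun c hc => ?_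
  rw [(Finset.mem_filter.1 hc).2]

/-- The planar point `p` as a complex number. -/
noncomputable def toComplex : EuclideanSpace ℝ (Fin 2) ≃ₗᵢ[ℝ] ℂ :=
  Complex.orthonormalBasisOneI.repr.symm

namespace SteinerTree

variable {d n : ℕ}

theorem le_shortestLength (T : SteinerTree d n) {a : ℝ}
    (h : ∀ x : T.topology.Vertex → EuclideanSpace ℝ (Fin d),
      (∀ i, x (Sum.inl i) = T.pos (Sum.inl i)) → a ≤ T.topology.length x) :
    a ≤ T.shortestLength :=
  haveI : Nonempty {x : T.topology.Vertex → EuclideanSpace ℝ (Fin d) //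
      ∀ i : Fin n, x (Sum.inl i) = T.pos (Sum.inl i)} := ⟨⟨T.pos, fun _ => rfl⟩⟩
  le_ciInf fun x => h x.1 x.2

/-- A flow of vectors of norm at most `1` along the edges that is conserved at the Steiner points
bounds the length of the shortest tree from below. -/
theorem sum_inner_le_shortestLength (T : SteinerTree 2 n) {r : T.topology.Vertex}
    {par : T.topology.Vertex → T.topology.Vertex} {dep : T.topology.Vertex → ℕ}
    (hR : T.topology.graph.IsRooting r par dep) (y : T.topology.Vertex → ℂ)
    (hy : ∀ v, ‖y v‖ ≤ 1)
    (hcons : ∀ s, ∑ c with par c = Sum.inr s, y c = y (Sum.inr s)) :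
    ∑ v, inner ℝ (y v) (toComplex (T.pos v) - toComplex (T.pos (par v))) ≤
      T.shortestLength := by
  refine T.le_shortestLength fun x hx => ?_
  rw [T.topology.length_eq_sum hR]
  calc ∑ v, inner ℝ (y v) (toComplex (T.pos v) - toComplex (T.pos (par v)))
      = ∑ v, inner ℝ (y v) (toComplex (x v) - toComplex (x (par v))) := by
        rw [sum_inner_sub_par par (fun v => toComplex (T.pos v)) y,
          sum_inner_sub_par par (fun v => toComplex (x v)) y]
        -- The coefficient of `x v` is the divergence of the flow: it vanishes at Steiner points,
        -- and at terminals `x` agrees with `T.pos`.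
        refine Finset.sum_congr rfl fun v _ => ?_
        rcases v with i | s
        · simp only [hx]
        · rw [hcons, sub_self, inner_zero_left, inner_zero_left]
    _ ≤ ∑ v, dist (x (par v)) (x v) := by
        refine Finset.sum_le_sum fun v _ => ?_
        rw [← toComplex.dist_map, dist_comm, dist_eq_norm]
        calc _ ≤ ‖y v‖ * ‖toComplex (x v) - toComplex (x (par v))‖ := real_inner_le_norm _ _
          _ ≤ _ := mul_le_of_le_one_left (norm_nonneg _) (hy v)

/-- The direction of the edge from `v` to `w`. -/
noncomputable def dir (T : SteinerTree 2 n) (v w : T.topology.Vertex) : ℂ :=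
  ((dist (T.pos v) (T.pos w))⁻¹ : ℝ) • (toComplex (T.pos w) - toComplex (T.pos v))

variable (T : SteinerTree 2 n)

theorem dist_smul_dir (v w : T.topology.Vertex) :
    dist (T.pos v) (T.pos w) • T.dir v w = toComplex (T.pos w) - toComplex (T.pos v) := by
  by_cases h : T.pos v = T.pos w
  · simp [h]
  · rw [dir, smul_inv_smul₀ (dist_ne_zero.2 h)]

theorem norm_dir {v w : T.topology.Vertex} (h : T.pos v ≠ T.pos w) : ‖T.dir v w‖ = 1 := by
  rw [dir, norm_smul, ← dist_eq_norm, toComplex.dist_map, dist_comm (T.pos w), Real.norm_eq_abs,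
    abs_of_nonneg (by positivity), inv_mul_cancel₀ (dist_ne_zero.2 h)]

theorem dir_swap (v w : T.topology.Vertex) : T.dir w v = -T.dir v w := by
  rw [dir, dir, dist_comm, ← smul_neg, neg_sub]

theorem angle_dir {s v w : T.topology.Vertex} (hv : T.pos s ≠ T.pos v) (hw : T.pos s ≠ T.pos w) :
    InnerProductGeometry.angle (T.dir s v) (T.dir s w) =
      EuclideanGeometry.angle (T.pos v) (T.pos s) (T.pos w) := by
  rw [dir, dir, InnerProductGeometry.angle_smul_left_of_pos _ _ (inv_pos.2 (dist_pos.2 hv)),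
    InnerProductGeometry.angle_smul_right_of_pos _ _ (inv_pos.2 (dist_pos.2 hw)), ← map_sub,
    ← map_sub, EuclideanGeometry.angle]
  exact toComplex.toLinearIsometry.angle_map _ _

theorem inner_edge (v w : T.topology.Vertex) (y : ℂ) :
    inner ℝ y (toComplex (T.pos w) - toComplex (T.pos v)) =
      dist (T.pos v) (T.pos w) * inner ℝ y (T.dir v w) := by
  rw [← dist_smul_dir, inner_smul_right]

/-- A conserved flow along the edges, with values in the unit disc, that makes an inner product of
at least `k` with the direction of each edge shows that the shortest tree is not shorter than
`k` times the tree. -/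
theorem mul_length_le_shortestLength {r : T.topology.Vertex}
    {par : T.topology.Vertex → T.topology.Vertex} {dep : T.topology.Vertex → ℕ}
    (hR : T.topology.graph.IsRooting r par dep) (y : T.topology.Vertex → ℂ)
    (hy : ∀ v, ‖y v‖ ≤ 1)
    (hcons : ∀ s, ∑ c with par c = Sum.inr s, y c = y (Sum.inr s)) {k : ℝ}
    (hk : ∀ v, v ≠ r → k ≤ inner ℝ (y v) (T.dir (par v) v)) :
    k * T.length ≤ T.shortestLength := by
  refine le_trans ?_ (T.sum_inner_le_shortestLength hR y hy hcons)
  rw [length, T.topology.length_eq_sum hR, Finset.mul_sum]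
  refine Finset.sum_le_sum fun v _ => ?_
  by_cases hv : v = r
  · simp [hv, hR.par_root]
  · rw [inner_edge, mul_comm]
    exact mul_le_mul_of_nonneg_left (hk v hv) dist_nonneg

theorem relativeError_le {M : ℝ} (hM : 0 ≤ M) (h : T.length ≤ (1 + M) * T.shortestLength) :
    T.relativeError ≤ ENNReal.ofReal M := by
  have h0 : 0 ≤ T.length := by
    rw [length, SteinerTopology.length]
    refine Finset.sum_nonneg fun e _ => ?_
    induction e with
    | _ v w => exact dist_nonneg (x := T.pos v) (y := T.pos w)
  rw [relativeError]
  rcases le_or_gt T.shortestLength 0 with hs | hs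
  · have h1 : (1 + M) * T.shortestLength ≤ 0 :=
      mul_nonpos_of_nonneg_of_nonpos (by linarith) hs
    -- Here both lengths vanish, and the quotient is `0 / 0 = 0`.
    have h2 : T.shortestLength = 0 := by nlinarith
    rw [h2, ENNReal.ofReal_of_nonpos (by nlinarith), ENNReal.zero_div]
    exact bot_le
  · rw [← ENNReal.ofReal_div_of_pos hs]
    refine ENNReal.ofReal_le_ofReal ?_
    rw [div_le_iff₀ hs]
    linarith

end SteinerTree

/-! ### Unit vectors at angles close to 2π/3 -/

/-- The two primitive cube roots of unity, for `τ = 1` and `τ = -1`. -/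
noncomputable def cubeRoot (τ : ℝ) : ℂ := ⟨-1 / 2, τ * (√3 / 2)⟩

theorem cubeRoot_add_neg (τ : ℝ) : cubeRoot τ + cubeRoot (-τ) = -1 := by
  apply Complex.ext <;> simp [cubeRoot]

theorem norm_cubeRoot {τ : ℝ} (h : τ = 1 ∨ τ = -1) : ‖cubeRoot τ‖ = 1 := by
  have h2 : τ * τ = 1 := by rcases h with rfl | rfl <;> norm_num
  have h3 : √3 * √3 = 3 := Real.mul_self_sqrt (by norm_num)
  rw [← sq_eq_sq₀ (norm_nonneg _) zero_le_one, Complex.sq_norm, Complex.normSq_apply]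
  simp only [cubeRoot]
  linear_combination (3 / 4) * h2 + τ * τ / 4 * h3

theorem exp_two_pi_div_three {τ : ℝ} (h : τ = 1 ∨ τ = -1) :
    Complex.exp (Complex.I * ((τ * (2 * Real.pi / 3) : ℝ) : ℂ)) = cubeRoot τ := by
  have hc : Real.cos (2 * Real.pi / 3) = -1 / 2 := by
    rw [show 2 * Real.pi / 3 = Real.pi - Real.pi / 3 by ring, Real.cos_pi_sub,
      Real.cos_pi_div_three]
    norm_num
  have hs : Real.sin (2 * Real.pi / 3) = √3 / 2 := by
    rw [show 2 * Real.pi / 3 = Real.pi - Real.pi / 3 by ring, Real.sin_pi_sub,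
      Real.sin_pi_div_three]
  rw [mul_comm]
  apply Complex.ext
  · rw [Complex.exp_ofReal_mul_I_re, cubeRoot]
    rcases h with rfl | rfl <;> simp [hc]
  · rw [Complex.exp_ofReal_mul_I_im, cubeRoot]
    rcases h with rfl | rfl <;> simp [hs]

/-- A unit vector that makes an angle close to `2π/3` with another one is close to one of the two
rotations of the other by `2π/3`. -/
theorem exists_cubeRoot_near {p a : ℂ} (hp : ‖p‖ = 1) (ha : ‖a‖ = 1) {ε : ℝ}
    (h : InnerProductGeometry.angle p a ∈
      Set.Icc (2 * Real.pi / 3 - ε) (2 * Real.pi / 3 + ε)) :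
    ∃ τ : ℝ, (τ = 1 ∨ τ = -1) ∧ ‖a - cubeRoot τ * p‖ ≤ ε := by
  have hp0 : p ≠ 0 := norm_ne_zero_iff.1 (by rw [hp]; exact one_ne_zero)
  have ha0 : a ≠ 0 := norm_ne_zero_iff.1 (by rw [ha]; exact one_ne_zero)
  rw [InnerProductGeometry.angle_comm, Complex.angle_eq_abs_arg ha0 hp0] at h
  set θ := (a / p).arg with hθ
  have hexp : a = Complex.exp (Complex.I * θ) * p := by
    have := Complex.norm_mul_exp_arg_mul_I (a / p)
    rw [norm_div, ha, hp, div_one, Complex.ofReal_one, one_mul, ← hθ, mul_comm] at this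
    rw [this, div_mul_cancel₀ _ hp0]
  have key : ∀ τ : ℝ, (τ = 1 ∨ τ = -1) → ‖a - cubeRoot τ * p‖ ≤ |θ - τ * (2 * Real.pi / 3)| := by
    intro τ hτ
    have h1 : a - cubeRoot τ * p = (Complex.exp (Complex.I * ((θ - τ * (2 * Real.pi / 3) : ℝ) : ℂ))
        - 1) * (cubeRoot τ * p) := by
      rw [sub_mul, ← exp_two_pi_div_three hτ, one_mul, ← mul_assoc, ← Complex.exp_add, ← mul_add,
        ← Complex.ofReal_add, sub_add_cancel, ← hexp]
    rw [h1, norm_mul, norm_mul, norm_cubeRoot hτ, hp, mul_one, mul_one]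
    -- A chord is no longer than its arc.
    exact Real.norm_exp_I_mul_ofReal_sub_one_le
  rcases le_total 0 θ with h0 | h0
  · rw [abs_of_nonneg h0] at h
    refine ⟨1, Or.inl rfl, (key 1 (Or.inl rfl)).trans ?_⟩
    rw [abs_le]
    constructor <;> linarith [h.1, h.2]
  · rw [abs_of_nonpos h0] at h
    refine ⟨-1, Or.inr rfl, (key (-1) (Or.inr rfl)).trans ?_⟩
    rw [abs_le]
    constructor <;> linarith [h.1, h.2]

/-- Three unit vectors with pairwise angles close to `2π/3` are close to three unit vectors with
sum zero. -/
theorem exists_cubeRoot_near_pair {p a b : ℂ} (hp : ‖p‖ = 1) (ha : ‖a‖ = 1) (hb : ‖b‖ = 1) {ε : ℝ}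
    (hε : ε ≤ 1 / 4)
    (hpa : InnerProductGeometry.angle p a ∈
      Set.Icc (2 * Real.pi / 3 - ε) (2 * Real.pi / 3 + ε))
    (hpb : InnerProductGeometry.angle p b ∈
      Set.Icc (2 * Real.pi / 3 - ε) (2 * Real.pi / 3 + ε))
    (hab : 2 * Real.pi / 3 - ε ≤ InnerProductGeometry.angle a b) :
    ∃ τ : ℝ, (τ = 1 ∨ τ = -1) ∧ ‖a - cubeRoot τ * p‖ ≤ ε ∧ ‖b - cubeRoot (-τ) * p‖ ≤ ε := by
  obtain ⟨τ, hτ, h1⟩ := exists_cubeRoot_near hp ha hpa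
  obtain ⟨σ, hσ, h2⟩ := exists_cubeRoot_near hp hb hpb
  by_cases h : σ = -τ
  · exact ⟨τ, hτ, h1, h ▸ h2⟩
  · have hst : σ = τ := by
      rcases hτ with rfl | rfl <;> rcases hσ with rfl | rfl <;>
        first | rfl | exact absurd (by norm_num) h
    rw [hst] at h2
    -- If both vectors were near the same rotation of `p`, they would be within `1/2` of each other;
    -- but their angle is at least π/2, so `‖a - b‖² ≥ 2`.
    have h3 : ‖a - b‖ ≤ 1 / 2 := by
      calc ‖a - b‖ = ‖(a - cubeRoot τ * p) - (b - cubeRoot τ * p)‖ := by ring_nf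
        _ ≤ _ := norm_sub_le _ _
        _ ≤ 1 / 2 := by linarith
    have h4 : inner ℝ a b ≤ 0 := by
      have hcos := InnerProductGeometry.cos_angle a b
      rw [ha, hb, mul_one, div_one] at hcos
      rw [← hcos]
      refine Real.cos_nonpos_of_pi_div_two_le_of_le ?_ ?_
      · linarith [Real.pi_gt_three]
      · linarith [InnerProductGeometry.angle_le_pi a b, Real.pi_pos]
    have h5 := norm_sub_sq_real a b
    rw [ha, hb] at h5
    nlinarith [norm_nonneg (a - b)]

/-- The cross product of two plane vectors. -/
def cross (a b : ℂ) : ℝ := a.re * b.im - a.im * b.re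

theorem abs_cross_le (a b : ℂ) : |cross a b| ≤ ‖a‖ * ‖b‖ := by
  have : cross a b = (conj a * b).im := by
    simp [cross]
    ring
  rw [this]
  refine (Complex.abs_im_le_norm _).trans ?_
  rw [norm_mul, Complex.norm_conj]

/-- Cramer's rule: it gives the weights that balance three plane vectors. -/
theorem cross_smul_add_cross_smul (p a b : ℂ) :
    cross b p • a + cross p a • b = cross a b • (-p) := by
  apply Complex.ext <;> simp [cross] <;> ring

theorem abs_cross_sub_le (a b a' b' : ℂ) :
    |cross a b - cross a' b'| ≤ ‖a - a'‖ * ‖b‖ + ‖a'‖ * ‖b - b'‖ := by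
  have : cross a b - cross a' b' = cross (a - a') b + cross a' (b - b') := by
    simp [cross]
    ring
  rw [this]
  exact (abs_add_le _ _).trans (add_le_add (abs_cross_le _ _) (abs_cross_le _ _))

theorem div_le_exp_of_near {X Y ε : ℝ} (h0 : 0 ≤ ε) (hε : ε ≤ 1 / 4) (hX : |X - √3 / 2| ≤ 2 * ε)
    (hY : |Y - √3 / 2| ≤ 2 * ε) : 0 < Y ∧ X / Y ≤ Real.exp (16 * ε) := by
  have h3 : (1.7 : ℝ) ≤ √3 := Real.le_sqrt_of_sq_le (by norm_num)
  rw [abs_le] at hX hY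
  have hY0 : 0.35 ≤ Y := by linarith
  refine ⟨by linarith, le_trans ?_ (Real.add_one_le_exp _)⟩
  -- `X - Y ≤ 4ε` and `Y ≥ 0.35`, so `X / Y ≤ 1 + 16ε`.
  rw [div_le_iff₀ (by linarith)]
  nlinarith

/-- Three unit vectors with pairwise angles close to `2π/3` can be balanced by weights that are
close to each other. -/
theorem exists_balancing_weights {p a b : ℂ} (hp : ‖p‖ = 1) (ha : ‖a‖ = 1) (hb : ‖b‖ = 1) {ε τ : ℝ}
    (hε : ε ≤ 1 / 4) (hτ : τ = 1 ∨ τ = -1) (h1 : ‖a - cubeRoot τ * p‖ ≤ ε)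
    (h2 : ‖b - cubeRoot (-τ) * p‖ ≤ ε) :
    ∃ α β : ℝ, α • a + β • b = -p ∧
      α ∈ Set.Icc (Real.exp (-(16 * ε))) (Real.exp (16 * ε)) ∧
      β ∈ Set.Icc (Real.exp (-(16 * ε))) (Real.exp (16 * ε)) := by
  have hε0 : 0 ≤ ε := (norm_nonneg _).trans h1
  have hττ : τ * τ = 1 := by rcases hτ with rfl | rfl <;> norm_num
  have habs : |τ| = 1 := by rcases hτ with rfl | rfl <;> norm_num
  have hpp : p.re * p.re + p.im * p.im = 1 := by
    rw [← Complex.normSq_apply, ← Complex.sq_norm, hp, one_pow]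
  have h1' : ‖cubeRoot τ * p‖ = 1 := by rw [norm_mul, norm_cubeRoot hτ, hp, one_mul]
  have h2' : ‖cubeRoot (-τ) * p‖ = 1 := by
    rw [norm_mul, norm_cubeRoot (hτ.symm.imp (by rintro rfl; norm_num) (by rintro rfl; rfl)), hp,
      one_mul]
  -- All three cross products are within `2ε` of `τ√3/2`, their value in the exact configuration;
  -- the factor `τ` makes them positive.
  have near : ∀ x y x' y' : ℂ, ‖x - x'‖ ≤ ε → ‖y - y'‖ ≤ ε → ‖y‖ = 1 → ‖x'‖ = 1 →
      cross x' y' = τ * (√3 / 2) → |τ * cross x y - √3 / 2| ≤ 2 * ε := by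
    intro x y x' y' hx hy hy1 hx1 h
    have : τ * cross x y - √3 / 2 = τ * (cross x y - cross x' y') := by
      rw [h]
      linear_combination (√3 / 2) * hττ
    rw [this, abs_mul, habs, one_mul]
    refine (abs_cross_sub_le _ _ _ _).trans ?_
    rw [hy1, hx1]
    linarith
  have hpp0 : ‖p - p‖ ≤ ε := by simpa using hε0
  have hA := near a b _ _ h1 h2 hb h1' (by
    simp only [cross, cubeRoot, Complex.mul_re, Complex.mul_im]
    linear_combination τ * (√3 / 2) * hpp)
  have hB := near b p _ p h2 hpp0 hp h2' (by
    simp only [cross, cubeRoot, Complex.mul_re, Complex.mul_im]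
    linear_combination τ * (√3 / 2) * hpp)
  have hC := near p a p _ hpp0 h1 ha hp (by
    simp only [cross, cubeRoot, Complex.mul_re, Complex.mul_im]
    linear_combination τ * (√3 / 2) * hpp)
  have hAB := div_le_exp_of_near hε0 hε hA hB
  have hAC := div_le_exp_of_near hε0 hε hA hC
  have hBA := div_le_exp_of_near hε0 hε hB hA
  have hCA := div_le_exp_of_near hε0 hε hC hA
  refine ⟨τ * cross b p / (τ * cross a b), τ * cross p a / (τ * cross a b), ?_, ⟨?_, hBA.2⟩,
    ⟨?_, hCA.2⟩⟩
  · have h := cross_smul_add_cross_smul p a b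
    have h0 : τ * cross a b ≠ 0 := hBA.1.ne'
    rw [← smul_right_inj h0, smul_add, smul_smul, smul_smul, mul_div_cancel₀ _ h0,
      mul_div_cancel₀ _ h0, mul_smul, mul_smul, mul_smul, ← smul_add, h]
  · rw [Real.exp_neg, ← inv_div]
    exact inv_anti₀ (div_pos hBA.1 hAB.1) hAB.2
  · rw [Real.exp_neg, ← inv_div]
    exact inv_anti₀ (div_pos hBA.1 hAC.1) hAC.2

/-! ### Two flows on an approximate tree -/

namespace SteinerTree

variable {n : ℕ} {T : SteinerTree 2 n} {ε : ℝ} {i₀ : Fin n}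
  {par : T.topology.Vertex → T.topology.Vertex} {dep : T.topology.Vertex → ℕ}

theorem exists_children_dir (hT : T.IsApproximate ε)
    (hR : T.topology.graph.IsRooting (Sum.inl i₀) par dep) (s : Fin T.topology.numSteiner) :
    ∃ a b, a ≠ b ∧ (∀ c, par c = Sum.inr s ↔ c = a ∨ c = b) ∧
      ‖T.dir (Sum.inr s) (par (Sum.inr s))‖ = 1 ∧ ‖T.dir (Sum.inr s) a‖ = 1 ∧
      ‖T.dir (Sum.inr s) b‖ = 1 ∧
      (ε ≤ 1 / 4 → ∃ τ : ℝ, (τ = 1 ∨ τ = -1) ∧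
        ‖T.dir (Sum.inr s) a - cubeRoot τ * T.dir (Sum.inr s) (par (Sum.inr s))‖ ≤ ε ∧
        ‖T.dir (Sum.inr s) b - cubeRoot (-τ) * T.dir (Sum.inr s) (par (Sum.inr s))‖ ≤ ε) := by
  obtain ⟨a, b, hab, hch, ha, hb, hap, hbp⟩ := hR.exists_children (v := Sum.inr s) (by simp)
    (T.topology.steiner_degree s)
  have hsp : T.topology.graph.Adj (Sum.inr s) (par (Sum.inr s)) :=
    (hR.adj_par _ (by simp)).symm
  have hsa : T.topology.graph.Adj (Sum.inr s) a := by
    have := hR.adj_par a ha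
    rwa [(hch a).2 (Or.inl rfl)] at this
  have hsb : T.topology.graph.Adj (Sum.inr s) b := by
    have := hR.adj_par b hb
    rwa [(hch b).2 (Or.inr rfl)] at this
  have hp' := hT.1 _ _ hsp
  have ha' := hT.1 _ _ hsa
  have hb' := hT.1 _ _ hsb
  refine ⟨a, b, hab, hch, T.norm_dir hp', T.norm_dir ha', T.norm_dir hb', fun hε => ?_⟩
  refine exists_cubeRoot_near_pair (T.norm_dir hp') (T.norm_dir ha') (T.norm_dir hb') hε ?_ ?_ ?_
  · rw [T.angle_dir hp' ha']
    exact hT.2 s _ _ hsp hsa hap.symm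
  · rw [T.angle_dir hp' hb']
    exact hT.2 s _ _ hsp hsb hbp.symm
  · rw [T.angle_dir ha' hb']
    exact (hT.2 s _ _ hsa hsb hab).1

theorem sum_children {a b v : T.topology.Vertex} (hab : a ≠ b)
    (hch : ∀ c, par c = v ↔ c = a ∨ c = b) (y : T.topology.Vertex → ℂ) :
    ∑ c with par c = v, y c = y a + y b := by
  rw [← Finset.sum_pair hab]
  refine Finset.sum_congr ?_ fun _ _ => rfl
  ext c
  simp [hch]

theorem par_eq_inr (hF : T.topology.IsFull)
    (hR : T.topology.graph.IsRooting (Sum.inl i₀) par dep) {v : T.topology.Vertex}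
    (hv : par v ≠ Sum.inl i₀) : ∃ s, par v = Sum.inr s := by
  rcases h : par v with i | s
  · rw [h] at hv
    exact absurd h (hR.par_ne_of_ncard_eq_one hv (hF i) v)
  · exact ⟨s, rfl⟩

/-- The flow that turns by exactly `2π/3` at each Steiner point. -/
theorem one_sub_mul_length_le (hT : T.IsApproximate ε) (hF : T.topology.IsFull)
    (hR : T.topology.graph.IsRooting (Sum.inl i₀) par dep) (h0 : 0 ≤ ε) (hε : ε ≤ 1 / 4) :
    (1 - (Fintype.card T.topology.Vertex * ε) ^ 2 / 2) * T.length ≤ T.shortestLength := by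
  choose a b hab hch hp ha hb hτ using exists_children_dir hT hR
  choose τ hτ1 hτa hτb using fun s => hτ s hε
  have hτ2 : ∀ s, -τ s = 1 ∨ -τ s = -1 := fun s => by
    rcases hτ1 s with h | h <;> simp [h]
  -- The value at the root is a dummy: the root has no edge to a parent.
  obtain ⟨y, hy0, hy⟩ := hR.exists_rec (fun v q => match par v with
    | Sum.inl _ => T.dir (par v) v
    | Sum.inr s => (if v = a s then -cubeRoot (τ s) else -cubeRoot (-τ s)) * q) (1 : ℂ)
  have hdir : ∀ v, v ≠ Sum.inl i₀ → ‖T.dir (par v) v‖ = 1 := fun v hv =>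
    T.norm_dir (hT.1 _ _ (hR.adj_par v hv))
  have hya : ∀ s, y (a s) = -cubeRoot (τ s) * y (Sum.inr s) := fun s => by
    have h := (hch s (a s)).2 (Or.inl rfl)
    rw [hy _ (by intro h'; rw [h', hR.par_root] at h; cases h), h]
    simp
  have hyb : ∀ s, y (b s) = -cubeRoot (-τ s) * y (Sum.inr s) := fun s => by
    have h := (hch s (b s)).2 (Or.inr rfl)
    rw [hy _ (by intro h'; rw [h', hR.par_root] at h; cases h), h]
    simp [(hab s).symm]
  have hroot : ∀ v, v ≠ Sum.inl i₀ → par v = Sum.inl i₀ → y v = T.dir (par v) v := by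
    intro v hv h
    rw [hy v hv, h]
  have hnorm : ∀ v, ‖y v‖ = 1 := by
    refine hR.induction (by rw [hy0, norm_one]) fun v hv ih => ?_
    by_cases h : par v = Sum.inl i₀
    · rw [hroot v hv h, hdir v hv]
    · obtain ⟨s, hs⟩ := par_eq_inr hF hR h
      rw [hs] at ih
      rcases (hch s v).1 hs with rfl | rfl
      · rw [hya, norm_mul, ih, norm_neg, norm_cubeRoot (hτ1 s), one_mul]
      · rw [hyb, norm_mul, ih, norm_neg, norm_cubeRoot (hτ2 s), one_mul]
  -- Multiplication by `-ω` is an isometry, so it carries the old error over unchanged; the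
  -- deviation of the angle adds at most `ε`.
  have hstep : ∀ (s : Fin T.topology.numSteiner) (u q ω : ℂ) (k : ℝ), ‖ω‖ = 1 →
      ‖u - ω * T.dir (Sum.inr s) (par (Sum.inr s))‖ ≤ ε →
      ‖q - T.dir (par (Sum.inr s)) (Sum.inr s)‖ ≤ k * ε → ‖-ω * q - u‖ ≤ (k + 1) * ε := by
    intro s u q ω k hω h1 h2
    have : -ω * q - u = -ω * (q - T.dir (par (Sum.inr s)) (Sum.inr s)) -
        (u - ω * T.dir (Sum.inr s) (par (Sum.inr s))) := by
      rw [T.dir_swap (par (Sum.inr s)) (Sum.inr s)]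
      ring
    rw [this]
    refine (norm_sub_le _ _).trans ?_
    rw [norm_mul, norm_neg, hω, one_mul]
    linarith
  have hdev : ∀ v, v ≠ Sum.inl i₀ → ‖y v - T.dir (par v) v‖ ≤ dep v * ε := by
    refine hR.induction (fun h => absurd rfl h) fun v hv ih _ => ?_
    by_cases h : par v = Sum.inl i₀
    · rw [hroot v hv h, sub_self, norm_zero]
      positivity
    · have ih' := ih h
      obtain ⟨s, hs⟩ := par_eq_inr hF hR h
      have hd := hR.depth_succ v hv
      rw [hs] at ih' hd
      rw [hs, hd, Nat.cast_add_one]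
      rcases (hch s v).1 hs with rfl | rfl
      · rw [hya]
        exact hstep s _ _ _ _ (norm_cubeRoot (hτ1 s)) (hτa s) ih'
      · rw [hyb]
        exact hstep s _ _ _ _ (norm_cubeRoot (hτ2 s)) (hτb s) ih'
  refine T.mul_length_le_shortestLength hR y (fun v => (hnorm v).le) (fun s => ?_) fun v hv => ?_
  · rw [sum_children (hab s) (hch s), hya, hyb]
    linear_combination -y (Sum.inr s) * cubeRoot_add_neg (τ s)
  · have h1 := norm_sub_sq_real (y v) (T.dir (par v) v)
    rw [hnorm, hdir v hv] at h1
    have h2 : ‖y v - T.dir (par v) v‖ ≤ Fintype.card T.topology.Vertex * ε := by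
      refine (hdev v hv).trans (mul_le_mul_of_nonneg_right ?_ h0)
      exact_mod_cast (hR.depth_lt v).le
    have h3 := pow_le_pow_left₀ (norm_nonneg _) h2 2
    linarith

/-- The flow in the directions of the edges. -/
theorem exp_mul_length_le (hT : T.IsApproximate ε) (hF : T.topology.IsFull)
    (hR : T.topology.graph.IsRooting (Sum.inl i₀) par dep) (h0 : 0 ≤ ε) (hε : ε ≤ 1 / 4) :
    Real.exp (-(32 * ε * Fintype.card T.topology.Vertex)) * T.length ≤ T.shortestLength := by
  choose a b hab hch hp ha hb hτ using exists_children_dir hT hR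
  choose τ hτ1 hτa hτb using fun s => hτ s hε
  choose α β hαβ hα hβ using fun s => exists_balancing_weights (hp s) (ha s) (hb s) hε (hτ1 s)
    (hτa s) (hτb s)
  obtain ⟨w, hw0, hw⟩ := hR.exists_rec (fun v q => match par v with
    | Sum.inl _ => 1
    | Sum.inr s => (if v = a s then α s else β s) * q) (1 : ℝ)
  set N : ℝ := ((Fintype.card T.topology.Vertex : ℕ) : ℝ)
  have hdir : ∀ v, v ≠ Sum.inl i₀ → ‖T.dir (par v) v‖ = 1 := fun v hv =>
    T.norm_dir (hT.1 _ _ (hR.adj_par v hv))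
  have hwa : ∀ s, w (a s) = α s * w (Sum.inr s) := fun s => by
    have h := (hch s (a s)).2 (Or.inl rfl)
    rw [hw _ (by intro h'; rw [h', hR.par_root] at h; cases h), h]
    simp
  have hwb : ∀ s, w (b s) = β s * w (Sum.inr s) := fun s => by
    have h := (hch s (b s)).2 (Or.inr rfl)
    rw [hw _ (by intro h'; rw [h', hR.par_root] at h; cases h), h]
    simp [(hab s).symm]
  have hstep : ∀ x q k : ℝ, x ∈ Set.Icc (Real.exp (-(16 * ε))) (Real.exp (16 * ε)) →
      q ∈ Set.Icc (Real.exp (-(16 * ε * k))) (Real.exp (16 * ε * k)) →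
      x * q ∈ Set.Icc (Real.exp (-(16 * ε * (k + 1)))) (Real.exp (16 * ε * (k + 1))) := by
    intro x q k hx hq
    have e1 : -(16 * ε * (k + 1)) = -(16 * ε) + -(16 * ε * k) := by ring
    have e2 : 16 * ε * (k + 1) = 16 * ε + 16 * ε * k := by ring
    have hq0 := (Real.exp_pos _).trans_le hq.1
    rw [e1, e2, Real.exp_add, Real.exp_add]
    exact ⟨mul_le_mul hx.1 hq.1 (Real.exp_pos _).le ((Real.exp_pos _).trans_le hx.1).le,
      mul_le_mul hx.2 hq.2 hq0.le (Real.exp_pos _).le⟩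
  have hbd : ∀ v, w v ∈ Set.Icc (Real.exp (-(16 * ε * dep v))) (Real.exp (16 * ε * dep v)) := by
    refine hR.induction ?_ fun v hv ih => ?_
    · simp [hw0, hR.depth_root]
    by_cases h : par v = Sum.inl i₀
    · rw [hw v hv, h]
      constructor
      · rw [Real.exp_le_one_iff, neg_nonpos]
        positivity
      · rw [Real.one_le_exp_iff]
        positivity
    · obtain ⟨s, hs⟩ := par_eq_inr hF hR h
      have hd := hR.depth_succ v hv
      rw [hs] at ih hd
      rw [hd, Nat.cast_add_one]
      rcases (hch s v).1 hs with rfl | rfl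
      · rw [hwa]
        exact hstep _ _ _ (hα s) ih
      · rw [hwb]
        exact hstep _ _ _ (hβ s) ih
  have hbd' : ∀ v, w v ∈ Set.Icc (Real.exp (-(16 * ε * N))) (Real.exp (16 * ε * N)) := by
    intro v
    have h1 : (dep v : ℝ) ≤ N := Nat.cast_le.2 (hR.depth_lt v).le
    have h2 : 16 * ε * dep v ≤ 16 * ε * N := mul_le_mul_of_nonneg_left h1 (by linarith)
    exact ⟨(Real.exp_le_exp.2 (neg_le_neg h2)).trans (hbd v).1,
      (hbd v).2.trans (Real.exp_le_exp.2 h2)⟩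
  have hpos : ∀ v, 0 < w v := fun v => (Real.exp_pos _).trans_le (hbd v).1
  -- The scaling brings all weights below 1; they stay above `exp (-(32εN))`.
  refine T.mul_length_le_shortestLength hR
    (fun v => (Real.exp (-(16 * ε * N)) * w v) • T.dir (par v) v) (fun v => ?_) (fun s => ?_)
    fun v hv => ?_
  · by_cases hv : v = Sum.inl i₀
    · simp [hv, hR.par_root, dir]
    · rw [norm_smul, hdir v hv, mul_one, Real.norm_eq_abs,
        abs_of_pos (mul_pos (Real.exp_pos _) (hpos v)), Real.exp_neg, inv_mul_le_one₀
        (Real.exp_pos _)]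
      exact (hbd' v).2
  · rw [sum_children (hab s) (hch s), (hch s _).2 (Or.inl rfl), (hch s _).2 (Or.inr rfl), hwa, hwb,
      T.dir_swap (Sum.inr s) (par (Sum.inr s)), ← hαβ s]
    module
  · rw [real_inner_smul_left, real_inner_self_eq_norm_sq, hdir v hv, one_pow, mul_one,
      show -(32 * ε * N) = -(16 * ε * N) + -(16 * ε * N) by ring, Real.exp_add]
    exact mul_le_mul_of_nonneg_left (hbd' v).1 (Real.exp_pos _).le

end SteinerTree

/-! ### A crude bound from angles alone -/

/-- By the law of cosines, `|ab|² ≥ |va|² sin² δ + (|vb| - |va| cos δ)²`. -/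
theorem dist_mul_sin_le {P : Type*} {V : Type*} [NormedAddCommGroup V] [InnerProductSpace ℝ V]
    [MetricSpace P] [NormedAddTorsor V P] {a v b : P} {δ : ℝ} (h0 : 0 ≤ δ)
    (h : δ ≤ EuclideanGeometry.angle a v b) : dist v a * Real.sin δ ≤ dist a b := by
  have h1 := EuclideanGeometry.law_cos a v b
  have h2 : Real.cos (EuclideanGeometry.angle a v b) ≤ Real.cos δ :=
    Real.cos_le_cos_of_nonneg_of_le_pi h0 (EuclideanGeometry.angle_le_pi _ _ _) h
  have h3 := mul_le_mul_of_nonneg_left h2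
    (mul_nonneg (dist_nonneg (x := a) (y := v)) (dist_nonneg (x := b) (y := v)))
  have h4 := Real.sin_sq_add_cos_sq δ
  rw [dist_comm v a]
  refine (abs_le_of_sq_le_sq' ?_ dist_nonneg).2
  nlinarith [sq_nonneg (dist b v - dist a v * Real.cos δ)]

namespace SteinerTree

section General

variable {d n : ℕ} (T : SteinerTree d n) {r : T.topology.Vertex}
    {par : T.topology.Vertex → T.topology.Vertex} {dep : T.topology.Vertex → ℕ}

theorem dist_root_le (hR : T.topology.graph.IsRooting r par dep)
    (x : T.topology.Vertex → EuclideanSpace ℝ (Fin d)) (v : T.topology.Vertex) :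
    dist (x r) (x v) ≤ dep v * T.topology.length x := by
  refine hR.induction (P := fun v => dist (x r) (x v) ≤ dep v * T.topology.length x)
    (by simp [hR.depth_root]) (fun v hv ih => ?_) v
  rw [hR.depth_succ v hv, Nat.cast_add_one, add_mul, one_mul]
  refine (dist_triangle _ (x (par v)) _).trans (add_le_add ih ?_)
  rw [T.topology.length_eq_sum hR]
  exact Finset.single_le_sum (f := fun v => dist (x (par v)) (x v)) (fun _ _ => dist_nonneg)
    (Finset.mem_univ v)

theorem shortestLength_nonneg (hR : T.topology.graph.IsRooting r par dep) :
    0 ≤ T.shortestLength := by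
  refine T.le_shortestLength fun x _ => ?_
  rw [T.topology.length_eq_sum hR]
  exact Finset.sum_nonneg fun _ _ => dist_nonneg

/-- Every competitor joins the two terminals by a path of fewer than `N` edges, each no longer than
the whole tree. -/
theorem dist_terminals_le {i : Fin n}
    (hR : T.topology.graph.IsRooting (Sum.inl i) par dep) (j : Fin n) :
    dist (T.pos (Sum.inl i)) (T.pos (Sum.inl j)) ≤
      Fintype.card T.topology.Vertex * T.shortestLength := by
  have hN : (0 : ℝ) < Fintype.card T.topology.Vertex :=
    Nat.cast_pos.2 (Fintype.card_pos_iff.2 ⟨Sum.inl i⟩)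
  rw [← div_le_iff₀' hN]
  refine T.le_shortestLength fun x hx => ?_
  rw [div_le_iff₀' hN, ← hx, ← hx]
  refine (T.dist_root_le hR x _).trans (mul_le_mul_of_nonneg_right ?_ ?_)
  · exact Nat.cast_le.2 (hR.depth_lt _).le
  · rw [T.topology.length_eq_sum hR]
    exact Finset.sum_nonneg fun _ _ => dist_nonneg

end General

variable {n : ℕ} {T : SteinerTree 2 n} {ε : ℝ} {i₀ : Fin n}
  {par : T.topology.Vertex → T.topology.Vertex} {dep : T.topology.Vertex → ℕ}

/-- If the angles at the Steiner points are bounded away from zero, then the length of the tree is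
bounded in terms of the length of the shortest tree and the number of vertices. -/
theorem length_le_of_angle (hT : T.IsApproximate ε)
    (hR : T.topology.graph.IsRooting (Sum.inl i₀) par dep) (h0 : 0 ≤ ε)
    (hε : ε < 2 * Real.pi / 3) :
    T.length ≤ 2 * (Fintype.card T.topology.Vertex : ℝ) ^ 2 *
      (1 + 2 / Real.sin (2 * Real.pi / 3 - ε)) ^ Fintype.card T.topology.Vertex *
        T.shortestLength := by
  have hs : 0 < Real.sin (2 * Real.pi / 3 - ε) :=
    Real.sin_pos_of_pos_of_lt_pi (by linarith) (by linarith [Real.pi_pos])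
  set K := 1 + 2 / Real.sin (2 * Real.pi / 3 - ε) with hK
  have hK1 : 1 ≤ K := le_add_of_nonneg_right (by positivity)
  set N := Fintype.card T.topology.Vertex
  have hL := T.shortestLength_nonneg hR
  set B := (N : ℝ) * T.shortestLength with hB
  have hB0 : 0 ≤ B := by positivity
  have key : ∀ (k : ℕ) (v : T.topology.Vertex), N ≤ dep v + k →
      dist (T.pos (Sum.inl i₀)) (T.pos v) ≤ K ^ k * B := by
    intro k
    induction k with
    | zero =>
      intro v hv
      have : dep v < N := hR.depth_lt v
      omega
    | succ k ih =>
      intro v hv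
      rcases v with i | s
      · exact (T.dist_terminals_le hR i).trans
          (le_mul_of_one_le_left hB0 (one_le_pow₀ hK1))
      · obtain ⟨a, b, hab, hch, ha, hb, hap, hbp⟩ := hR.exists_children (v := Sum.inr s) (by simp)
          (T.topology.steiner_degree s)
        have hpa := (hch a).2 (Or.inl rfl)
        have hpb := (hch b).2 (Or.inr rfl)
        have hsa := hR.adj_par a ha
        have hsb := hR.adj_par b hb
        have hda := hR.depth_succ a ha
        have hdb := hR.depth_succ b hb
        rw [hpa] at hsa hda
        rw [hpb] at hsb hdb
        have hia := ih a (by omega)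
        have hib := ih b (by omega)
        have h1 := dist_mul_sin_le (by linarith) (hT.2 s a b hsa hsb hab).1
        have h2 := dist_triangle_left (T.pos a) (T.pos b) (T.pos (Sum.inl i₀))
        have h3 := dist_triangle_right (T.pos (Sum.inl i₀)) (T.pos (Sum.inr s)) (T.pos a)
        have h4 : dist (T.pos (Sum.inr s)) (T.pos a) ≤
            2 * (K ^ k * B) / Real.sin (2 * Real.pi / 3 - ε) := by
          rw [le_div_iff₀ hs]
          linarith
        calc _ ≤ K ^ k * B + 2 * (K ^ k * B) / Real.sin (2 * Real.pi / 3 - ε) := by linarith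
          _ = K ^ (k + 1) * B := by
            rw [pow_succ, hK]
            ring
  have hN := fun v => key N v (Nat.le_add_left _ _)
  rw [length, T.topology.length_eq_sum hR]
  calc ∑ v, dist (T.pos (par v)) (T.pos v) ≤ ∑ _v : T.topology.Vertex, 2 * (K ^ N * B) := by
        refine Finset.sum_le_sum fun v _ => ?_
        have h := dist_triangle_left (T.pos (par v)) (T.pos v) (T.pos (Sum.inl i₀))
        linarith [hN v, hN (par v)]
    _ = _ := by
        rw [Finset.sum_const, Finset.card_univ, nsmul_eq_mul, hB]
        ring

theorem IsApproximate.mono {d : ℕ} {T : SteinerTree d n} {ε' : ℝ} (hT : T.IsApproximate ε)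
    (h : ε ≤ ε') : T.IsApproximate ε' :=
  ⟨hT.1, fun s v w hv hw hvw =>
    ⟨by linarith [(hT.2 s v w hv hw hvw).1], by linarith [(hT.2 s v w hv hw hvw).2]⟩⟩

end SteinerTree

/-! ### Assembling the three regimes -/

theorem exists_steinerF_le (ε₁ : ℝ) (h₁ : ε₁ < 2 * Real.pi / 3) :
    ∃ C : ℝ, ∀ (n : ℕ) (ε : ℝ), 3 ≤ n → 0 < ε → ε < Real.pi / ((n : ℝ) - 2) → ε ≤ ε₁ →
      steinerF 2 ε n ≤ ENNReal.ofReal (C * ((n : ℝ) ^ 2 * ε ^ 2)) := by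
  set K := 1 + 2 / Real.sin (2 * Real.pi / 3 - max ε₁ 0) with hK
  have hm : max ε₁ 0 < 2 * Real.pi / 3 := max_lt h₁ (by positivity)
  have hK1 : 1 ≤ K := by
    have : 0 < Real.sin (2 * Real.pi / 3 - max ε₁ 0) :=
      Real.sin_pos_of_pos_of_lt_pi (by linarith) (by linarith [Real.pi_pos, le_max_right ε₁ 0])
    exact le_add_of_nonneg_right (by positivity)
  set M := 2 * (28 : ℝ) ^ 2 * K ^ 28 + Real.exp 640 with hM
  have hM0 : 0 ≤ M := by positivity
  -- The `4` serves `2nε ≤ 1`, where the error is at most `(2nε)²`; the `4 * M` serves `2nε > 1`,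
  -- where `4n²ε² ≥ 1`.
  refine ⟨4 * M + 4, fun n ε hn h0 hε hε₁ => ?_⟩
  refine iSup₂_le fun T hT => ?_
  obtain ⟨hF, hA⟩ := hT
  have hn' : (3 : ℝ) ≤ n := by exact_mod_cast hn
  obtain ⟨par, dep, hR⟩ := T.topology.isTree.exists_isRooting (Sum.inl ⟨0, by omega⟩)
  have hcard : Fintype.card T.topology.Vertex ≤ 2 * n := by
    have := hF.numSteiner_add_two
    simp only [Fintype.card_sum, Fintype.card_fin]
    omega
  have hcard' : (Fintype.card T.topology.Vertex : ℝ) ≤ 2 * n := by exact_mod_cast hcard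
  have hL := T.shortestLength_nonneg hR
  refine T.relativeError_le (by positivity) ?_
  have hεn : ε * (n - 2) < Real.pi := (lt_div_iff₀ (by linarith)).1 hε
  have hpi := Real.pi_lt_d2
  rcases le_or_gt (2 * n * ε) 1 with h | h
  · have h1 := SteinerTree.one_sub_mul_length_le hA hF hR h0.le (by nlinarith)
    have hlen : 0 ≤ T.length := by
      rw [SteinerTree.length, T.topology.length_eq_sum hR]
      exact Finset.sum_nonneg fun _ _ => dist_nonneg
    have h2 : (Fintype.card T.topology.Vertex * ε) ^ 2 ≤ (2 * n * ε) ^ 2 :=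
      pow_le_pow_left₀ (by positivity) (mul_le_mul_of_nonneg_right hcard' h0.le) 2
    set t := (2 * n * ε) ^ 2 / 2 with ht
    have ht1 : t ≤ 1 / 2 := by
      have := pow_le_one₀ (n := 2) (by positivity) h
      linarith
    have ht0 : 0 ≤ t := by positivity
    have h3 : (1 - t) * T.length ≤ T.shortestLength :=
      (mul_le_mul_of_nonneg_right (by linarith) hlen).trans h1
    have h4 : T.length ≤ (1 + 2 * t) * T.shortestLength := by
      -- `(1 + 2t)(1 - t) ≥ 1` because `t ≤ 1/2`.
      calc T.length ≤ (1 + 2 * t) * ((1 - t) * T.length) := by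
            nlinarith [mul_nonneg (mul_nonneg ht0 hlen) (sub_nonneg.2 ht1)]
        _ ≤ _ := mul_le_mul_of_nonneg_left h3 (by positivity)
    refine h4.trans (mul_le_mul_of_nonneg_right ?_ hL)
    have : 0 ≤ M * (n ^ 2 * ε ^ 2) := by positivity
    nlinarith
  · have h1 : 1 ≤ 4 * (n ^ 2 * ε ^ 2 : ℝ) := by nlinarith
    suffices h2 : T.length ≤ M * T.shortestLength by
      refine h2.trans (mul_le_mul_of_nonneg_right ?_ hL)
      nlinarith
    rcases le_or_gt n 14 with hn14 | hn14
    · have h2 := SteinerTree.length_le_of_angle (hA.mono (hε₁.trans (le_max_left ε₁ 0))) hR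
        (le_max_right _ _) hm
      rw [← hK] at h2
      refine h2.trans (mul_le_mul_of_nonneg_right ?_ hL)
      have h28 : Fintype.card T.topology.Vertex ≤ 28 := by omega
      have h28' : (Fintype.card T.topology.Vertex : ℝ) ≤ 28 := by exact_mod_cast h28
      refine le_trans ?_ (le_add_of_nonneg_right (Real.exp_pos _).le)
      gcongr
    -- `n = 15` is where `ε < π / (n - 2)` first gives `ε ≤ 1/4`. The exponent is at most `64nε`,
    -- and `nε < π + 2ε`, so `640` is ample.
    · have hn15 : (15 : ℝ) ≤ n := by exact_mod_cast hn14
      have h2 := SteinerTree.exp_mul_length_le hA hF hR h0.le (by nlinarith)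
      rw [Real.exp_neg, inv_mul_le_iff₀ (Real.exp_pos _)] at h2
      refine h2.trans (mul_le_mul_of_nonneg_right ?_ hL)
      refine le_trans (Real.exp_le_exp.2 ?_) (le_add_of_nonneg_left (by positivity))
      have h3 : ε * Fintype.card T.topology.Vertex ≤ ε * (2 * n) :=
        mul_le_mul_of_nonneg_left hcard' h0.le
      nlinarith

theorem mainTheorem4 :
    (∀ ε₁ : ℝ, ε₁ < 2 * Real.pi / 3 →
      ∃ C : ℝ, ∀ (n : ℕ) (ε : ℝ), 3 ≤ n → 0 < ε → ε < Real.pi / ((n : ℝ) - 2) → ε ≤ ε₁ →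
        steinerF 2 ε n ≤ ENNReal.ofReal (C * ((n : ℝ) ^ 2 * ε ^ 2))) ∧
    (∀ K : ℝ, ∃ (C : ℝ) (N : ℕ), ∀ (n : ℕ) (ε : ℝ), N ≤ n → 3 ≤ n → 0 < ε →
      ε ≤ K / (n : ℝ) ^ 2 →
        steinerF 2 ε n ≤ ENNReal.ofReal (C * ε)) := by
  refine ⟨exists_steinerF_le, fun K => ?_⟩
  obtain ⟨C, hC⟩ := exists_steinerF_le 1 (by linarith [Real.pi_gt_three])
  -- For `n ≥ K`, the bound `εn² ≤ K` gives `εn ≤ 1`, hence both conditions on `ε` in the first part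
  -- with `ε₁ = 1`.
  refine ⟨max C 0 * K, ⌈K⌉₊ + 1, fun n ε hN hn h0 hε => ?_⟩
  have hn' : (3 : ℝ) ≤ n := by exact_mod_cast hn
  have hKn : K ≤ n := (Nat.le_ceil K).trans (by exact_mod_cast (Nat.le_succ _).trans hN)
  have hε' : ε * n ^ 2 ≤ K := (le_div_iff₀ (by positivity)).1 hε
  have hεn : ε * n ≤ 1 := by
    by_contra! h
    nlinarith
  refine (hC n ε hn h0 ?_ (by nlinarith)).trans (ENNReal.ofReal_le_ofReal ?_)
  · rw [lt_div_iff₀ (by linarith)]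
    nlinarith [Real.pi_gt_three]
  · calc C * (n ^ 2 * ε ^ 2) ≤ max C 0 * (n ^ 2 * ε ^ 2) :=
          mul_le_mul_of_nonneg_right (le_max_left _ _) (by positivity)
      _ = max C 0 * (ε * n ^ 2) * ε := by ring
      _ ≤ max C 0 * K * ε :=
          mul_le_mul_of_nonneg_right (mul_le_mul_of_nonneg_left hε' (le_max_right _ _)) h0.le
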